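/- Let $[r]=\{1,\dots,r\}$ and let $\binom{[r]}{2}$ be the set of unordered pairs of distinct elements of $[r]$. Problem $Q^*$ for $\boldsymbol{k}=(3;7)$, that is, for seven colours with a triangle forbidden in each of them, asks for the maximum $Q(\boldsymbol{k})$ of $$q(\phi,\boldsymbol{\alpha})=2\sum_{1\le i<j\le r}\alpha_i\alpha_j\log_2|\phi(ij)|$$ over all feasible triples $(r,\phi,\boldsymbol{\alpha})$, where $r\ge 1$ is an integer, $\boldsymbol{\alpha}\in\mathbb{R}^r$ has $\alpha_i>0$ for all $i$ and $\alpha_1+\dots+\alpha_r=1$, and $\phi$ assigns to each pair $ij\in\binom{[r]}{2}$ a set $\phi(ij)\subseteq\{1,\dots,7\}$ with $|\phi(ij)|\ge 2$ such that for every colour $c\in\{1,\dots,7\}$ the graph $\phi^{-1}(c)$ on $[r]$ with edge set $\{ij: c\in\phi(ij)\}$ is triangle-free. A feasible triple is optimal if it attains the maximum. Theorem. The maximum is attained and $Q(\boldsymbol{k})=\frac74$. Moreover, for a triple $(r,\phi,\boldsymbol{\alpha})$ with $r$ a non-negative integer, $\phi:\binom{[r]}{2}\to 2^{\{1,\dots,7\}}$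 and $\boldsymbol{\alpha}\in\mathbb{R}^r$, the following are equivalent: (a) $(r,\phi,\boldsymbol{\alpha})$ is an optimal solution of Problem $Q^*$; (b) $r=8$, $\alpha_i=\frac18$ for all $i$, $|\phi(ij)|=4$ for all $ij\in\binom{[8]}{2}$, and $\phi^{-1}(c)\cong K_{4,4}$ for every $c\in\{1,\dots,7\}$; (c) $r=8$, $\alpha_i=\frac18$ for all $i$, and there is a Hadamard matrix $H$ of order $8$ (an $8\times 8$ matrix with entries $\pm1$ and $HH^{\mathsf T}=8I_8$), with rows labelled $1,\dots,8$ and columns labelled $0,\dots,7$, whose column $0$ is the all-ones vector, such that for every $c\in\{1,\dots,7\}$ the graph $\phi^{-1}(c)$ is the complete bipartite graph whose vertex classes are the sets of row indices of the $1$-entries and of the $-1$-entries of column $c$. -/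

import Mathlib

namespace ErdosRothschild

/-- The set of unordered pairs of distinct elements of an `r`-element set. -/
abbrev Pair (r : ℕ) : Type := {e : Sym2 (Fin r) // ¬ e.IsDiag}

/-- The pair `ij`, for distinct `i` and `j`. -/
def pair {r : ℕ} {i j : Fin r} (h : i ≠ j) : Pair r := ⟨s(i, j), by simpa using h⟩

/-- A triple `(r, φ, α)`: a number of parts, an assignment of a set of colours to every pair of
distinct parts, and a weight for every part. The `s` colours are the elements of `Fin s`. -/
structure Triple (s : ℕ) where
  r : ℕ
  φ : Pair r → Finset (Fin s)
  α : Fin r → ℝ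

/-- The graph `φ⁻¹(c)`, whose edges are the pairs `ij` with `c ∈ φ(ij)`. -/
def colourGraph {r s : ℕ} (φ : Pair r → Finset (Fin s)) (c : Fin s) : SimpleGraph (Fin r) :=
  SimpleGraph.fromEdgeSet (Subtype.val '' {e : Pair r | c ∈ φ e})

/-- The set `Φ₂(r; k)` of colour patterns. -/
def patterns (r : ℕ) {s : ℕ} (k : Fin s → ℕ) : Set (Pair r → Finset (Fin s)) :=
  {φ | (∀ c, (colourGraph φ c).CliqueFree (k c)) ∧ ∀ e, 2 ≤ (φ e).card}

/-- The set `Δ^r` of vertex weightings. -/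
def weightings (r : ℕ) : Set (Fin r → ℝ) :=
  {α | (∀ i, 0 < α i) ∧ ∑ i, α i = 1}

/-- The set of feasible solutions of Problem `Q*`. -/
def feas {s : ℕ} (k : Fin s → ℕ) : Set (Triple s) :=
  {x | 1 ≤ x.r ∧ x.φ ∈ patterns x.r k ∧ x.α ∈ weightings x.r}

/-- The objective `2 ∑_{ij} α_i α_j log₂ |φ(ij)|`; each unordered pair is counted once, and
`(Sym2.map α s(i, j)).mul` is `α i * α j`. -/
noncomputable def objective {s : ℕ} (x : Triple s) : ℝ :=
  2 * ∑ e : Pair x.r, (Sym2.map x.α e.val).mul * Real.logb 2 ((x.φ e).card : ℝ)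

/-- The optimal value of Problem `Q*`. -/
noncomputable def optValue {s : ℕ} (k : Fin s → ℕ) : ℝ :=
  sSup (objective '' feas k)

/-- The set of optimal solutions of Problem `Q*`. -/
def opt {s : ℕ} (k : Fin s → ℕ) : Set (Triple s) :=
  {x | x ∈ feas k ∧ ∀ y ∈ feas k, objective y ≤ objective x}

/-- There are `8` parts of equal weight, every pair gets exactly `4` colours, and every colour
graph is isomorphic to `K_{4,4}`. -/
def IsBalanced (x : Triple 7) : Prop :=
  x.r = 8 ∧ (∀ i, x.α i = 1 / 8) ∧ (∀ e, (x.φ e).card = 4) ∧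
    ∀ c, Nonempty (colourGraph x.φ c ≃g completeBipartiteGraph (Fin 4) (Fin 4))

/-- The triple is read off a Hadamard matrix `H` of order `8`, with columns `0, …, 7`, whose
column `0` is constant `1`: the weights are uniform, and the graph of the colour with index `c`
(for `c = 0, …, 6`) is complete bipartite, its vertex classes being the sets of row indices of the
`1`-entries and of the `-1`-entries of column `c + 1`. -/
def IsFromHadamard (x : Triple 7) : Prop :=
  ∃ (φ : Pair 8 → Finset (Fin 7)) (H : Matrix (Fin 8) (Fin 8) ℝ),
    x = ⟨8, φ, fun _ => 1 / 8⟩ ∧ H.IsHadamard ∧ (∀ i, H i 0 = 1) ∧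
      ∀ (i j : Fin 8) (h : i ≠ j) (c : Fin 7), c ∈ φ (pair h) ↔ H i c.succ ≠ H j c.succ

end ErdosRothschild

namespace ErdosRothschild

open Finset

/-! Give each colour a symmetric sign matrix, with -1 on its edges and 1 elsewhere, diagonal
included. For an ordered triple of vertices, let `t` be the inner product, over the colours, of the
sign vectors of two of its sides. Averaged over triples with weights `α`, both `t` and `t ^ 2` are
sums of weighted squares (`energy`, `pairEnergy`), and the diagonal terms of the latter contribute
exactly 7.

If every colour appears on none or two of the sides, then `t = 7 - 2 * d`, where `d` is the number
of colours on the third side. A quadratic in `7 - 2 * d` that majorizes `log₂ d` then bounds the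
logarithm by a function of `t`. A colour on exactly one side spoils this identity, but summed over
the three corners the bound survives (`triangle_term`). Averaging and discarding the squares
(`sum_cornerTerm`) leaves `9/5 - 7/140 = 7/4`.

Equality makes all of this tight: every pair has four colours, the sign matrices are multiplicative
along triangles, so that each colour is a cut, and their weighted row sums vanish. The signs
relative to one vertex, together with a column of ones, then form a Hadamard matrix. -/

/-! ### A quadratic majorant of `log₂` -/

lemma logb_two_three_lt : Real.logb 2 3 < 3 / 2 + 6 / 70 := by
  rw [Real.logb_lt_iff_lt_rpow (by norm_num) (by norm_num)]
  -- The bounds at 3, 5, 6 and 7 are the exact values of the majorant there; clearing denominators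
  -- leaves integer inequalities, here `3 ^ 70 < 2 ^ 111`.
  have h : ((3 : ℝ) ^ 70) < ((2 : ℝ) ^ ((3 / 2 + 6 / 70 : ℝ))) ^ 70 := by
    rw [← Real.rpow_natCast ((2 : ℝ) ^ _), ← Real.rpow_mul (by norm_num)]
    rw [show ((3 / 2 + 6 / 70 : ℝ) * ((70 : ℕ) : ℝ)) = ((111 : ℕ) : ℝ) by norm_num,
      Real.rpow_natCast]
    norm_num
  exact lt_of_pow_lt_pow_left₀ 70 (by positivity) h

lemma logb_two_five_lt : Real.logb 2 5 < 5 / 2 - 10 / 70 := by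
  rw [Real.logb_lt_iff_lt_rpow (by norm_num) (by norm_num)]
  have h : ((5 : ℝ) ^ 14) < ((2 : ℝ) ^ ((5 / 2 - 10 / 70 : ℝ))) ^ 14 := by
    rw [← Real.rpow_natCast ((2 : ℝ) ^ _), ← Real.rpow_mul (by norm_num)]
    rw [show ((5 / 2 - 10 / 70 : ℝ) * ((14 : ℕ) : ℝ)) = ((33 : ℕ) : ℝ) by norm_num,
      Real.rpow_natCast]
    norm_num
  exact lt_of_pow_lt_pow_left₀ 14 (by positivity) h

lemma logb_two_six_lt : Real.logb 2 6 < 3 - 24 / 70 := by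
  rw [show (6 : ℝ) = 2 * 3 by norm_num, Real.logb_mul (by norm_num) (by norm_num),
    Real.logb_self_eq_one (by norm_num)]
  linarith [logb_two_three_lt]

lemma logb_two_seven_lt : Real.logb 2 7 < 7 / 2 - 42 / 70 := by
  rw [Real.logb_lt_iff_lt_rpow (by norm_num) (by norm_num)]
  have h : ((7 : ℝ) ^ 10) < ((2 : ℝ) ^ ((7 / 2 - 42 / 70 : ℝ))) ^ 10 := by
    rw [← Real.rpow_natCast ((2 : ℝ) ^ _), ← Real.rpow_mul (by norm_num)]
    rw [show ((7 / 2 - 42 / 70 : ℝ) * ((10 : ℕ) : ℝ)) = ((29 : ℕ) : ℝ) by norm_num,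
      Real.rpow_natCast]
    norm_num
  exact lt_of_pow_lt_pow_left₀ 10 (by positivity) h

lemma logb_two_four : Real.logb 2 4 = 2 := by
  rw [show (4 : ℝ) = 2 ^ (2 : ℕ) by norm_num, Real.logb_pow, Real.logb_self_eq_one (by norm_num)]
  norm_num

/-- The gap between the polynomial majorant of `log₂` on `{0, …, 7}` (a combination of the
first three Krawtchouk polynomials of the 7-cube) and `log₂` itself. -/
noncomputable def gap (d : ℕ) : ℝ :=
  7 / 4 - 29 / 140 * (7 - 2 * (d : ℝ)) - 1 / 140 * ((7 - 2 * (d : ℝ)) ^ 2 - 7) - Real.logb 2 d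

lemma gap_two : gap 2 = 8 / 70 := by
  norm_num [gap]

lemma gap_pos {d : ℕ} (hd : d ≤ 7) (h0 : d ≠ 0) (h4 : d ≠ 4) : 0 < gap d := by
  have h3 := logb_two_three_lt
  have h5 := logb_two_five_lt
  have h6 := logb_two_six_lt
  have h7 := logb_two_seven_lt
  interval_cases d
  · exact absurd rfl h0
  · norm_num [gap]
  · norm_num [gap_two]
  · norm_num [gap] at *; linarith
  · exact absurd rfl h4
  · norm_num [gap] at *; linarith
  · norm_num [gap] at *; linarith
  · norm_num [gap] at *; linarith

lemma gap_nonneg {d : ℕ} (hd : d ≤ 7) : 0 ≤ gap d := by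
  by_cases h0 : d = 0
  -- Since `Real.logb 2 0 = 0`, the majorant is also tight at 0, which is the value of `d` on
  -- diagonal pairs.
  · subst h0; norm_num [gap]
  by_cases h4 : d = 4
  · subst h4; have := logb_two_four; norm_num [gap, this]
  exact (gap_pos hd h0 h4).le

/-! ### The inequality for a single triangle -/

/-- The contribution of one edge of a triangle: `a` of the `x` colours that appear on exactly
one edge appear on this one, `b` colours miss this edge only, and `o` colours miss exactly one
of the other two edges. -/
lemma edge_term_nonneg {a x b o : ℕ} (hax : a ≤ x) (hs : x + b + o ≤ 7)
    (hd : a + o = 0 ∨ 2 ≤ a + o) :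
    0 ≤ (a : ℝ) * (43 / 2 - x - 4 * b) + 35 * gap (a + o) ∧
      ((a : ℝ) * (43 / 2 - x - 4 * b) + 35 * gap (a + o) = 0 →
        a = 0 ∧ (a + o = 0 ∨ a + o = 4)) := by
  have hd7 : a + o ≤ 7 := by omega
  have hg := gap_nonneg hd7
  rcases Nat.eq_zero_or_pos a with rfl | ha
  · simp only [Nat.cast_zero, zero_mul, zero_add] at hg ⊢
    refine ⟨by linarith, fun h => ⟨trivial, ?_⟩⟩
    by_contra hne
    push Not at hne
    have := gap_pos (d := o) (by omega) hne.1 hne.2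
    linarith
  · suffices h : 0 < (a : ℝ) * (43 / 2 - x - 4 * b) + 35 * gap (a + o) from
      ⟨h.le, fun h' => absurd h' h.ne'⟩
    -- With `a ≥ 1`, the first factor can be negative only for `(x, b) = (2, 5)` or `(1, 6)`. The
    -- latter forces `a + o = 1`, which is excluded; the former gives `-1 + 35 * gap 2 = 3`.
    by_cases hx : x = 2 ∧ b = 5
    · obtain ⟨rfl, rfl⟩ := hx
      obtain ⟨rfl, rfl⟩ : a = 2 ∧ o = 0 := by omega
      norm_num [gap_two]
    · have hlt : 2 * x + 8 * b < 43 := by omega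
      have hlt' : (2 : ℝ) * x + 8 * b < 43 := by exact_mod_cast hlt
      have ha' : (0 : ℝ) < a := by exact_mod_cast ha
      have : 0 < (a : ℝ) * (43 / 2 - x - 4 * b) := mul_pos ha' (by linarith)
      linarith

/-- The sign attached to a proposition: `-1` if it holds and `1` otherwise. -/
noncomputable def sgn (p : Prop) [Decidable p] : ℝ := if p then -1 else 1

lemma sgn_eq_mul {p q r : Prop} [Decidable p] [Decidable q] [Decidable r]
    (h : ¬ (p ∧ q ∧ r)) (h₁ : ¬ (p ∧ ¬ q ∧ ¬ r)) (h₂ : ¬ (¬ p ∧ q ∧ ¬ r))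
    (h₃ : ¬ (¬ p ∧ ¬ q ∧ r)) : sgn p = sgn q * sgn r := by
  by_cases hp : p <;> by_cases hq : q <;> by_cases hr : r <;> simp_all [sgn]

section Triangle

variable (P Q R : Fin 7 → Prop) [DecidablePred P] [DecidablePred Q] [DecidablePred R]

lemma sum_sgn : ∑ c, sgn (P c) = 7 - 2 * (#{c | P c} : ℝ) := by
  have : ∀ c, sgn (P c) = 1 - 2 * (if P c then (1 : ℝ) else 0) := by
    intro c; unfold sgn; split_ifs <;> norm_num
  simp only [this, sum_sub_distrib, ← mul_sum, card_filter]
  push_cast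
  simp

lemma card_split (h : ∀ c, ¬ (P c ∧ Q c ∧ R c)) :
    #{c | P c} = #{c | P c ∧ ¬ Q c ∧ ¬ R c} + (#{c | P c ∧ ¬ Q c ∧ R c} +
      #{c | P c ∧ Q c ∧ ¬ R c}) := by
  simp only [card_filter, ← sum_add_distrib]
  refine sum_congr rfl fun c _ => ?_
  have := h c
  by_cases hP : P c <;> by_cases hQ : Q c <;> by_cases hR : R c <;> simp_all

lemma sum_sgn_mul_sgn (h : ∀ c, ¬ (P c ∧ Q c ∧ R c)) :
    ∑ c, sgn (P c) * sgn (Q c) = 7 - 2 * ((#{c | P c ∧ ¬ Q c ∧ ¬ R c} : ℝ) +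
      #{c | P c ∧ ¬ Q c ∧ R c} + #{c | ¬ P c ∧ Q c ∧ ¬ R c} + #{c | ¬ P c ∧ Q c ∧ R c}) := by
  have h7 : (7 : ℝ) = ∑ c : Fin 7, (1 : ℝ) := by simp
  simp only [card_filter]
  push_cast
  rw [← sum_add_distrib, ← sum_add_distrib, ← sum_add_distrib, mul_sum, h7, ← sum_sub_distrib]
  refine sum_congr rfl fun c _ => ?_
  have := h c
  by_cases hP : P c <;> by_cases hQ : Q c <;> by_cases hR : R c <;> simp_all [sgn] <;> norm_num

/-- One corner of the triangle inequality: the edge with colours `P`, seen from the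
opposite corner. -/
noncomputable def cornerTerm : ℝ :=
  7 / 4 - Real.logb 2 (#{c | P c} : ℝ) + 1 / 20
    - 29 / 140 * ∑ c, sgn (Q c) * sgn (R c) - 1 / 140 * (∑ c, sgn (Q c) * sgn (R c)) ^ 2

lemma card_singles_add_le (h : ∀ c, ¬ (P c ∧ Q c ∧ R c)) :
    #{c | P c ∧ ¬ Q c ∧ ¬ R c} + #{c | ¬ P c ∧ Q c ∧ ¬ R c} + #{c | ¬ P c ∧ ¬ Q c ∧ R c} +
      #{c | ¬ P c ∧ Q c ∧ R c} + #{c | P c ∧ ¬ Q c ∧ R c} + #{c | P c ∧ Q c ∧ ¬ R c} ≤ 7 := by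
  have h7 : 7 = ∑ c : Fin 7, 1 := by simp
  conv_rhs => rw [h7]
  simp only [card_filter, ← sum_add_distrib]
  refine sum_le_sum fun c _ => ?_
  clear h7
  have := h c
  by_cases hP : P c <;> by_cases hQ : Q c <;> by_cases hR : R c <;> simp_all

/-- Sorting the colours by the set of sides on which they appear splits the sum into three edge
terms. Equality leaves no colour on exactly one side, which is the multiplicativity of signs. -/
lemma triangle_term (h : ∀ c, ¬ (P c ∧ Q c ∧ R c))
    (hP : #{c | P c} = 0 ∨ 2 ≤ #{c | P c}) (hQ : #{c | Q c} = 0 ∨ 2 ≤ #{c | Q c})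
    (hR : #{c | R c} = 0 ∨ 2 ≤ #{c | R c}) :
    0 ≤ cornerTerm P Q R + cornerTerm Q R P + cornerTerm R P Q ∧
      (cornerTerm P Q R + cornerTerm Q R P + cornerTerm R P Q = 0 →
        (#{c | P c} = 0 ∨ #{c | P c} = 4) ∧ ∀ c, sgn (P c) = sgn (Q c) * sgn (R c)) := by
  have hQ' : ∀ c, ¬ (Q c ∧ P c ∧ R c) := fun c hc => h c ⟨hc.2.1, hc.1, hc.2.2⟩
  have hR' : ∀ c, ¬ (R c ∧ P c ∧ Q c) := fun c hc => h c ⟨hc.2.1, hc.2.2, hc.1⟩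
  have cP := card_split P Q R h
  have cQ := card_split Q P R hQ'
  have cR := card_split R P Q hR'
  have sPQ := sum_sgn_mul_sgn P Q R h
  have sQR := sum_sgn_mul_sgn Q R P fun c hc => h c ⟨hc.2.2, hc.1, hc.2.1⟩
  have sRP := sum_sgn_mul_sgn R P Q hR'
  have hle := card_singles_add_le P Q R h
  have e1 : #{c | Q c ∧ ¬ P c ∧ ¬ R c} = #{c | ¬ P c ∧ Q c ∧ ¬ R c} := by
    congr 1; ext c; simp; tauto
  have e2 : #{c | Q c ∧ ¬ P c ∧ R c} = #{c | ¬ P c ∧ Q c ∧ R c} := by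
    congr 1; ext c; simp; tauto
  have e3 : #{c | Q c ∧ P c ∧ ¬ R c} = #{c | P c ∧ Q c ∧ ¬ R c} := by
    congr 1; ext c; simp; tauto
  have e4 : #{c | R c ∧ ¬ P c ∧ ¬ Q c} = #{c | ¬ P c ∧ ¬ Q c ∧ R c} := by
    congr 1; ext c; simp; tauto
  have e5 : #{c | R c ∧ ¬ P c ∧ Q c} = #{c | ¬ P c ∧ Q c ∧ R c} := by
    congr 1; ext c; simp; tauto
  have e6 : #{c | R c ∧ P c ∧ ¬ Q c} = #{c | P c ∧ ¬ Q c ∧ R c} := by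
    congr 1; ext c; simp; tauto
  have e7 : #{c | Q c ∧ ¬ R c ∧ ¬ P c} = #{c | ¬ P c ∧ Q c ∧ ¬ R c} := by
    congr 1; ext c; simp; tauto
  have e8 : #{c | Q c ∧ ¬ R c ∧ P c} = #{c | P c ∧ Q c ∧ ¬ R c} := by
    congr 1; ext c; simp; tauto
  have e9 : #{c | ¬ Q c ∧ R c ∧ ¬ P c} = #{c | ¬ P c ∧ ¬ Q c ∧ R c} := by
    congr 1; ext c; simp; tauto
  have e10 : #{c | ¬ Q c ∧ R c ∧ P c} = #{c | P c ∧ ¬ Q c ∧ R c} := by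
    congr 1; ext c; simp; tauto
  have e11 : #{c | ¬ R c ∧ P c ∧ ¬ Q c} = #{c | P c ∧ ¬ Q c ∧ ¬ R c} := by
    congr 1; ext c; simp; tauto
  have e12 : #{c | ¬ R c ∧ P c ∧ Q c} = #{c | P c ∧ Q c ∧ ¬ R c} := by
    congr 1; ext c; simp; tauto
  rw [e1, e2, e3] at cQ
  rw [e4, e5, e6] at cR
  rw [e7, e8, e9, e10] at sQR
  rw [e4, e5, e11, e12] at sRP
  have hzero : #{c | P c ∧ ¬ Q c ∧ ¬ R c} = 0 → #{c | ¬ P c ∧ Q c ∧ ¬ R c} = 0 →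
      #{c | ¬ P c ∧ ¬ Q c ∧ R c} = 0 → ∀ c, sgn (P c) = sgn (Q c) * sgn (R c) := by
    intro h1 h2 h3 c
    simp only [card_eq_zero, filter_eq_empty_iff, mem_univ, true_implies] at h1 h2 h3
    exact sgn_eq_mul (h c) (@h1 c) (@h2 c) (@h3 c)
  generalize #{c | P c ∧ ¬ Q c ∧ ¬ R c} = x₁ at *
  generalize #{c | ¬ P c ∧ Q c ∧ ¬ R c} = x₂ at *
  generalize #{c | ¬ P c ∧ ¬ Q c ∧ R c} = x₃ at *
  generalize #{c | ¬ P c ∧ Q c ∧ R c} = y₁ at *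
  generalize #{c | P c ∧ ¬ Q c ∧ R c} = y₂ at *
  generalize #{c | P c ∧ Q c ∧ ¬ R c} = y₃ at *
  rw [cP] at hP
  rw [cQ] at hQ
  rw [cR] at hR
  have t₁ := edge_term_nonneg (a := x₁) (x := x₁ + x₂ + x₃) (b := y₁) (o := y₂ + y₃)
    (by omega) (by omega) hP
  have t₂ := edge_term_nonneg (a := x₂) (x := x₁ + x₂ + x₃) (b := y₂) (o := y₁ + y₃)
    (by omega) (by omega) hQ
  have t₃ := edge_term_nonneg (a := x₃) (x := x₁ + x₂ + x₃) (b := y₃) (o := y₁ + y₂)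
    (by omega) (by omega) hR
  -- With `x = x₁ + x₂ + x₃`, the inner product opposite side `i` is `7 - 2 * dᵢ - 2 * (x - 2 *
  -- xᵢ)`. The corrections `x - 2 * xᵢ` add up to `x`, whence the coefficient `43/2 = 29/2 + 7`.
  have key : 35 * (cornerTerm P Q R + cornerTerm Q R P + cornerTerm R P Q) =
      ((x₁ : ℝ) * (43 / 2 - (x₁ + x₂ + x₃ : ℕ) - 4 * y₁) + 35 * gap (x₁ + (y₂ + y₃))) +
      ((x₂ : ℝ) * (43 / 2 - (x₁ + x₂ + x₃ : ℕ) - 4 * y₂) + 35 * gap (x₂ + (y₁ + y₃))) +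
      ((x₃ : ℝ) * (43 / 2 - (x₁ + x₂ + x₃ : ℕ) - 4 * y₃) + 35 * gap (x₃ + (y₁ + y₂))) := by
    simp only [cornerTerm, gap, sPQ, sQR, sRP, cP, cQ, cR]
    push_cast
    ring
  refine ⟨by linarith [t₁.1, t₂.1, t₃.1], fun h0 => ?_⟩
  have z₁ := t₁.2 (by linarith [t₁.1, t₂.1, t₃.1])
  have z₂ := t₂.2 (by linarith [t₁.1, t₂.1, t₃.1])
  have z₃ := t₃.2 (by linarith [t₁.1, t₂.1, t₃.1])
  exact ⟨cP ▸ z₁.2, hzero z₁.1 z₂.1 z₃.1⟩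

end Triangle

/-! ### Averaging over weighted triangles -/

section Mult

variable {V : Type*} (G : Fin 7 → SimpleGraph V) [∀ c, DecidableRel (G c).Adj]

/-- The number of colours of the pair `ij`. -/
def mult (i j : V) : ℕ := #{c | (G c).Adj i j}

lemma mult_self (i : V) : mult G i i = 0 := by simp [mult]

lemma sgn_comm (c : Fin 7) (i j : V) : sgn ((G c).Adj i j) = sgn ((G c).Adj j i) := by
  simp [sgn, (G c).adj_comm]

end Mult

lemma sum_rotate {V : Type*} [Fintype V] (F : V → V → V → ℝ) :
    ∑ i, ∑ j, ∑ k, F j k i = ∑ i, ∑ j, ∑ k, F i j k := by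
  rw [sum_comm]
  exact sum_congr rfl fun j _ => sum_comm

lemma sum_comm_triple {ι V : Type*} [Fintype ι] [Fintype V] (F : ι → V → V → V → ℝ) :
    ∑ p, ∑ i, ∑ j, ∑ k, F p i j k = ∑ i, ∑ j, ∑ k, ∑ p, F p i j k := by
  rw [sum_comm]
  refine sum_congr rfl fun i _ => ?_
  rw [sum_comm]
  exact sum_congr rfl fun j _ => sum_comm

section Weighted

variable {V : Type*} [Fintype V] {α : V → ℝ}

lemma sum_triple_const (hα : ∑ i, α i = 1) (a : ℝ) :
    ∑ i, ∑ j, ∑ k, α i * α j * α k * a = a := by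
  simp only [← sum_mul, ← mul_sum, hα, mul_one, one_mul]

lemma sum_triple_pair (hα : ∑ i, α i = 1) (f : V → V → ℝ) :
    ∑ i, ∑ j, ∑ k, α i * α j * α k * f i j = ∑ i, ∑ j, α i * α j * f i j := by
  refine sum_congr rfl fun i _ => sum_congr rfl fun j _ => ?_
  simp only [← sum_mul, ← mul_sum, hα, mul_one]

/-- Fixing the common vertex `k` separates the sums over `i` and `j` into two equal factors; this is
the source of the squares. -/
lemma sum_triple_symm (s : V → V → ℝ) (hs : ∀ i j, s i j = s j i) :
    ∑ i, ∑ j, ∑ k, α i * α j * α k * (s j k * s k i) = ∑ k, α k * (∑ i, α i * s i k) ^ 2 := by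
  rw [← sum_rotate]
  refine sum_congr rfl fun k _ => ?_
  rw [sq, sum_mul_sum, mul_sum]
  rw [sum_comm]
  refine sum_congr rfl fun j _ => ?_
  rw [mul_sum]
  refine sum_congr rfl fun i _ => ?_
  rw [hs k i]
  ring

variable (G : Fin 7 → SimpleGraph V) [∀ c, DecidableRel (G c).Adj]

lemma sgn_sq (p : Prop) [Decidable p] : sgn p * sgn p = 1 := by
  unfold sgn; split_ifs <;> norm_num

variable (α) in
/-- The weighted mean square of the weighted row sums of the entrywise product of the sign
matrices of two colours. -/
noncomputable def pairEnergy (c c' : Fin 7) : ℝ :=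
  ∑ k, α k * (∑ i, α i * (sgn ((G c).Adj i k) * sgn ((G c').Adj i k))) ^ 2

variable (α) in
/-- The weighted mean square of the weighted row sums of the sign matrix of a colour. -/
noncomputable def energy (c : Fin 7) : ℝ :=
  ∑ k, α k * (∑ i, α i * sgn ((G c).Adj i k)) ^ 2

lemma sum_cornerTerm (hα : ∑ i, α i = 1) :
    ∑ i, ∑ j, ∑ k, α i * α j * α k * cornerTerm (fun c => (G c).Adj i j) (fun c => (G c).Adj j k)
        (fun c => (G c).Adj k i) =
      9 / 5 - ∑ i, ∑ j, α i * α j * Real.logb 2 (mult G i j) - 29 / 140 * ∑ c, energy α G c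
        - 1 / 140 * ∑ c, ∑ c', pairEnergy α G c c' := by
  have h₁ : ∑ c, energy α G c = ∑ i, ∑ j, ∑ k, α i * α j * α k *
      ∑ c, sgn ((G c).Adj j k) * sgn ((G c).Adj k i) := by
    simp only [energy]
    rw [sum_congr rfl fun c _ => (sum_triple_symm (α := α) (fun i j => sgn ((G c).Adj i j))
      (sgn_comm G c)).symm]
    simp only [sum_comm_triple, mul_sum]
  have h₂ : ∑ c, ∑ c', pairEnergy α G c c' = ∑ i, ∑ j, ∑ k, α i * α j * α k *
      (∑ c, sgn ((G c).Adj j k) * sgn ((G c).Adj k i)) ^ 2 := by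
    simp only [pairEnergy]
    rw [sum_congr rfl fun c _ => sum_congr rfl fun c' _ => (sum_triple_symm (α := α)
      (fun i j => sgn ((G c).Adj i j) * sgn ((G c').Adj i j))
      (fun i j => by rw [sgn_comm G c, sgn_comm G c'])).symm]
    simp only [sum_comm_triple]
    refine sum_congr rfl fun i _ => sum_congr rfl fun j _ => sum_congr rfl fun k _ => ?_
    rw [sq, sum_mul_sum, mul_sum]
    refine sum_congr rfl fun c _ => ?_
    rw [mul_sum]
    refine sum_congr rfl fun c' _ => ?_
    ring
  rw [h₁, h₂, ← sum_triple_pair hα, ← sum_triple_const hα (9 / 5)]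
  simp only [mul_sum (s := (univ : Finset V)), ← sum_sub_distrib]
  refine sum_congr rfl fun i _ => sum_congr rfl fun j _ => sum_congr rfl fun k _ => ?_
  simp only [cornerTerm, mult]
  ring

lemma energy_nonneg (hα : ∀ i, 0 < α i) (c : Fin 7) : 0 ≤ energy α G c :=
  sum_nonneg fun k _ => mul_nonneg (hα k).le (sq_nonneg _)

lemma pairEnergy_nonneg (hα : ∀ i, 0 < α i) (c c' : Fin 7) : 0 ≤ pairEnergy α G c c' :=
  sum_nonneg fun k _ => mul_nonneg (hα k).le (sq_nonneg _)

lemma pairEnergy_self (hα : ∑ i, α i = 1) (c : Fin 7) : pairEnergy α G c c = 1 := by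
  simp [pairEnergy, sgn_sq, hα]

lemma sum_pairEnergy (hα : ∑ i, α i = 1) :
    ∑ c, ∑ c', pairEnergy α G c c' = 7 + ∑ c, ∑ c' ∈ univ.erase c, pairEnergy α G c c' := by
  have : ∀ c, ∑ c', pairEnergy α G c c' = 1 + ∑ c' ∈ univ.erase c, pairEnergy α G c c' := by
    intro c
    rw [← add_sum_erase univ _ (mem_univ c), pairEnergy_self G hα]
  simp only [this, sum_add_distrib]
  simp

lemma sum_eq_zero_of_weighted_sq (hα : ∀ i, 0 < α i) (f : V → ℝ)
    (h : ∑ k, α k * f k ^ 2 = 0) (k : V) : f k = 0 := by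
  rw [sum_eq_zero_iff_of_nonneg fun k _ => mul_nonneg (hα k).le (sq_nonneg _)] at h
  have := h k (mem_univ k)
  simpa [(hα k).ne'] using this

/-- The upper bound `7 / 4`, and what equality entails. -/
theorem sum_logb_mult_le (hpos : ∀ i, 0 < α i) (hsum : ∑ i, α i = 1)
    (hG : ∀ c, (G c).CliqueFree 3) (hm : ∀ i j, i ≠ j → 2 ≤ mult G i j) :
    ∑ i, ∑ j, α i * α j * Real.logb 2 (mult G i j) ≤ 7 / 4 ∧
      (∑ i, ∑ j, α i * α j * Real.logb 2 (mult G i j) = 7 / 4 →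
        (∀ i j, i ≠ j → mult G i j = 4) ∧
        (∀ c i j k, sgn ((G c).Adj i j) = sgn ((G c).Adj j k) * sgn ((G c).Adj k i)) ∧
        (∀ c k, ∑ i, α i * sgn ((G c).Adj i k) = 0)) := by
  have hm' : ∀ i j, mult G i j = 0 ∨ 2 ≤ mult G i j := by
    intro i j
    by_cases h : i = j
    · exact .inl (h ▸ mult_self G i)
    · exact .inr (hm i j h)
  have ht : ∀ i j k c, ¬ ((G c).Adj i j ∧ (G c).Adj j k ∧ (G c).Adj k i) := by
    classical
    rintro i j k c ⟨h1, h2, h3⟩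
    exact hG c {i, j, k} (SimpleGraph.is3Clique_triple_iff.2 ⟨h1, h3.symm, h2⟩)
  set C : V → V → V → ℝ := fun i j k => cornerTerm (fun c => (G c).Adj i j)
    (fun c => (G c).Adj j k) (fun c => (G c).Adj k i) with hC
  have htri := fun i j k => triangle_term (fun c => (G c).Adj i j) (fun c => (G c).Adj j k)
    (fun c => (G c).Adj k i) (ht i j k) (hm' i j) (hm' j k) (hm' k i)
  have hw : ∀ i j k, 0 < α i * α j * α k := fun i j k =>
    mul_pos (mul_pos (hpos i) (hpos j)) (hpos k)
  have hcyc : ∑ i, ∑ j, ∑ k, α i * α j * α k * (C i j k + C j k i + C k i j) =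
      3 * ∑ i, ∑ j, ∑ k, α i * α j * α k * C i j k := by
    have r₁ := sum_rotate fun i j k => α i * α j * α k * C i j k
    have r₂ := sum_rotate fun i j k => α j * α k * α i * C j k i
    have e : ∑ i, ∑ j, ∑ k, α i * α j * α k * (C i j k + C j k i + C k i j) =
        ∑ i, ∑ j, ∑ k, α i * α j * α k * C i j k + ∑ i, ∑ j, ∑ k, α j * α k * α i * C j k i +
        ∑ i, ∑ j, ∑ k, α k * α i * α j * C k i j := by
      simp only [← sum_add_distrib]
      refine sum_congr rfl fun i _ => sum_congr rfl fun j _ => sum_congr rfl fun k _ => ?_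
      ring
    rw [e]
    linarith
  have hmain := sum_cornerTerm G hsum
  have hterm : ∀ i j k, 0 ≤ α i * α j * α k * (C i j k + C j k i + C k i j) := fun i j k =>
    mul_nonneg (hw i j k).le (htri i j k).1
  have h3 : 0 ≤ ∑ i, ∑ j, ∑ k, α i * α j * α k * (C i j k + C j k i + C k i j) :=
    sum_nonneg fun i _ => sum_nonneg fun j _ => sum_nonneg fun k _ => hterm i j k
  have hE : 0 ≤ ∑ c, energy α G c := sum_nonneg fun c _ => energy_nonneg G hpos c
  have hF : 0 ≤ ∑ c, ∑ c' ∈ univ.erase c, pairEnergy α G c c' :=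
    sum_nonneg fun c _ => sum_nonneg fun c' _ => pairEnergy_nonneg G hpos c c'
  rw [sum_pairEnergy G hsum] at hmain
  change ∑ i, ∑ j, ∑ k, α i * α j * α k * C i j k = _ at hmain
  refine ⟨by linarith, fun heq => ?_⟩
  have hE0 : ∑ c, energy α G c = 0 := by linarith
  have h30 : ∑ i, ∑ j, ∑ k, α i * α j * α k * (C i j k + C j k i + C k i j) = 0 := by linarith
  have hC0 : ∀ i j k, C i j k + C j k i + C k i j = 0 := by
    intro i j k
    have a := (sum_eq_zero_iff_of_nonneg fun i _ => sum_nonneg fun j _ => sum_nonneg fun k _ =>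
      hterm i j k).1 h30 i (mem_univ i)
    have b := (sum_eq_zero_iff_of_nonneg fun j _ => sum_nonneg fun k _ =>
      hterm i j k).1 a j (mem_univ j)
    have c := (sum_eq_zero_iff_of_nonneg fun k _ => hterm i j k).1 b k (mem_univ k)
    exact (mul_eq_zero.1 c).resolve_left (hw i j k).ne'
  refine ⟨fun i j hij => ?_, fun c i j k => ((htri i j k).2 (hC0 i j k)).2 c, fun c k => ?_⟩
  -- The degenerate triangle `i, j, i` already determines the multiplicity.
  · have h1 : mult G i j = 0 ∨ mult G i j = 4 := ((htri i j i).2 (hC0 i j i)).1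
    have h2 := hm i j hij
    omega
  · have := (sum_eq_zero_iff_of_nonneg fun c _ => energy_nonneg G hpos c).1 hE0 c (mem_univ c)
    exact sum_eq_zero_of_weighted_sq hpos _ this k

end Weighted

/-! ### From triples and unordered pairs to sums over ordered pairs -/

lemma colourGraph_adj {r s : ℕ} (φ : Pair r → Finset (Fin s)) (c : Fin s) (i j : Fin r) :
    (colourGraph φ c).Adj i j ↔ ∃ h : i ≠ j, c ∈ φ (pair h) := by
  simp only [colourGraph, SimpleGraph.fromEdgeSet_adj, Set.mem_image, Set.mem_ofPred_eq]
  constructor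
  · rintro ⟨⟨e, he, h⟩, hij⟩
    exact ⟨hij, by rwa [show pair hij = e from Subtype.ext h.symm]⟩
  · rintro ⟨h, hc⟩
    exact ⟨⟨pair h, hc, rfl⟩, h⟩

lemma colourGraph_adj_of_ne {r s : ℕ} (φ : Pair r → Finset (Fin s)) (c : Fin s) {i j : Fin r}
    (h : i ≠ j) : (colourGraph φ c).Adj i j ↔ c ∈ φ (pair h) := by
  rw [colourGraph_adj]
  exact ⟨fun ⟨_, hc⟩ => hc, fun hc => ⟨h, hc⟩⟩

lemma exists_eq_pair {r : ℕ} (e : Pair r) : ∃ (i j : Fin r) (h : i ≠ j), e = pair h := by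
  obtain ⟨e, he⟩ := e
  induction e with
  | h i j => exact ⟨i, j, by simpa using he, rfl⟩

open Classical in
lemma mult_colourGraph {r : ℕ} (φ : Pair r → Finset (Fin 7)) {i j : Fin r} (h : i ≠ j) :
    mult (colourGraph φ) i j = (φ (pair h)).card := by
  simp [mult, colourGraph_adj_of_ne φ _ h]

/-- A sum over ordered pairs of a symmetric function vanishing on the diagonal is twice the sum
over unordered pairs. -/
lemma sum_sum_sym2 {r : ℕ} (p : Sym2 (Fin r) → ℝ) (hp : ∀ i, p s(i, i) = 0) :
    ∑ i, ∑ j, p s(i, j) = 2 * ∑ e : Pair r, p e.val := by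
  have h₁ : ∑ e : Pair r, p e.val = ∑ i, ∑ j, if i < j then p s(i, j) else 0 := by
    rw [← Fintype.sum_prod_type', ← sum_filter]
    rw [← sum_subtype (univ.sym2.filter fun e : Sym2 (Fin r) => ¬ e.IsDiag) (by simp) p,
      sum_sym2_filter_not_isDiag]
    refine sum_congr ?_ fun _ _ => rfl
    ext ⟨i, j⟩
    simpa using fun h => ne_of_lt h
  have h₂ : ∑ i, ∑ j, (if i < j then p s(i, j) else 0) =
      ∑ i, ∑ j, if j < i then p s(i, j) else 0 := by
    rw [sum_comm]
    refine sum_congr rfl fun i _ => sum_congr rfl fun j _ => ?_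
    rw [Sym2.eq_swap]
  rw [two_mul]
  nth_rewrite 2 [h₁]
  rw [h₁, h₂]
  nth_rewrite 1 [← h₂]
  simp only [← sum_add_distrib]
  refine sum_congr rfl fun i _ => sum_congr rfl fun j _ => ?_
  rcases lt_trichotomy i j with h | h | h
  · simp [h, h.not_gt]
  · simp [h, hp]
  · simp [h, h.not_gt]

open Classical in
lemma objective_eq_sum (x : Triple 7) : objective x =
    ∑ i, ∑ j, x.α i * x.α j * Real.logb 2 (mult (colourGraph x.φ) i j) := by
  have h := sum_sum_sym2 (fun e => (Sym2.map x.α e).mul *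
    Real.logb 2 (#{c | e ∈ (colourGraph x.φ c).edgeSet} : ℝ)) (by simp)
  have h' : ∑ i, ∑ j, x.α i * x.α j * Real.logb 2 (mult (colourGraph x.φ) i j) =
      ∑ i, ∑ j, (Sym2.map x.α s(i, j)).mul *
        Real.logb 2 (#{c | s(i, j) ∈ (colourGraph x.φ c).edgeSet} : ℝ) := by
    simp [mult]
  rw [h', h, objective]
  congr 1
  refine sum_congr rfl fun e _ => ?_
  obtain ⟨i, j, hij, rfl⟩ := exists_eq_pair e
  congr 3
  rw [← mult_colourGraph x.φ hij]
  simp [mult, pair]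

open Classical in
lemma objective_le {x : Triple 7} (hx : x ∈ feas (fun _ : Fin 7 => 3)) : objective x ≤ 7 / 4 := by
  obtain ⟨-, ⟨hG, hφ⟩, hpos, hsum⟩ := hx
  rw [objective_eq_sum]
  exact (sum_logb_mult_le _ hpos hsum hG fun i j h => mult_colourGraph x.φ h ▸ hφ _).1

/-! ### Equality: recovering a Hadamard matrix -/

lemma sgn_eq_mul_sgn_iff {p q r : Prop} [Decidable p] [Decidable q] [Decidable r]
    (h : sgn p = sgn q * sgn r) : p ↔ sgn r ≠ sgn q := by
  revert h
  by_cases hp : p <;> by_cases hq : q <;> by_cases hr : r <;> norm_num [sgn, hp, hq, hr]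

lemma sgn_mem_unitary (p : Prop) [Decidable p] : sgn p ∈ unitary ℝ := by
  rw [Unitary.mem_iff]
  simp [sgn_sq]

open Classical in
lemma isFromHadamard_of_objective_eq {x : Triple 7} (hx : x ∈ feas (fun _ : Fin 7 => 3))
    (hobj : objective x = 7 / 4) : IsFromHadamard x := by
  obtain ⟨r, φ, α⟩ := x
  obtain ⟨hr, ⟨hG, hφ⟩, hpos, hsum⟩ := hx
  rw [objective_eq_sum] at hobj
  dsimp only at *
  obtain ⟨hmult, hcut, hbal⟩ := (sum_logb_mult_le _ hpos hsum hG fun i j h =>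
    mult_colourGraph φ h ▸ hφ _).2 hobj
  have hS : ∀ i j, ∑ c, sgn ((colourGraph φ c).Adj i j) = 8 * (if i = j then 1 else 0) - 1 := by
    intro i j
    rw [sum_sgn]
    change 7 - 2 * (mult (colourGraph φ) i j : ℝ) = _
    split_ifs with h
    · subst h; rw [mult_self]; norm_num
    · rw [hmult i j h]; norm_num
  have hα : ∀ i, α i = 1 / 8 := by
    intro k
    -- Summing the balance conditions over all colours and exchanging sums gives `8 * α k - 1 = 0`.
    have h : ∑ c, ∑ i, α i * sgn ((colourGraph φ c).Adj i k) = 0 :=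
      sum_eq_zero fun c _ => hbal c k
    rw [sum_comm] at h
    simp only [← mul_sum, hS, mul_sub, sum_sub_distrib, mul_one, hsum] at h
    simp at h
    linarith
  obtain rfl : r = 8 := by
    simp only [hα, sum_const, card_univ, Fintype.card_fin, nsmul_eq_mul] at hsum
    have : (r : ℝ) = 8 := by linarith
    exact_mod_cast this
  obtain rfl : α = fun _ => 1 / 8 := funext hα
  -- Vertex 0 serves as reference: the column of a colour records the side of its cut relative to
  -- vertex 0. Multiplicativity makes the product of two rows the sign vector of their pair, so `hS`
  -- gives orthogonality.
  refine ⟨φ, Matrix.of fun i c => Fin.cases 1 (fun c => sgn ((colourGraph φ c).Adj i 0)) c,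
    rfl, ?_, fun i => rfl, ?_⟩
  · refine Matrix.IsHadamard.of_mul_conjTranspose (fun i c => ?_) ?_ ?_
    · cases c using Fin.cases with
      | zero => exact one_mem _
      | succ c => exact sgn_mem_unitary _
    · ext i j
      rw [Matrix.mul_apply, Fin.sum_univ_succ]
      simp only [Matrix.conjTranspose_apply, Matrix.of_apply, Fin.cases_zero, Fin.cases_succ,
        star_trivial]
      have : ∀ c, sgn ((colourGraph φ c).Adj i 0) * sgn ((colourGraph φ c).Adj j 0) =
          sgn ((colourGraph φ c).Adj i j) := fun c => by
        rw [hcut c i j 0, sgn_comm _ c 0 i, mul_comm]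
      simp only [this, hS]
      simp [Matrix.one_apply]
    · exact IsRegular.of_ne_zero (by simp)
  · intro i j h c
    rw [← colourGraph_adj_of_ne φ c h]
    have := sgn_eq_mul_sgn_iff (hcut c i j 0)
    rw [this, sgn_comm _ c 0 i]
    rfl

/-! ### From Hadamard matrices back to optimal triples -/

lemma eq_one_or_eq_neg_one_of_isHadamard {n : Type*} [Fintype n] [DecidableEq n]
    {H : Matrix n n ℝ} (hH : H.IsHadamard) (i j : n) : H i j = 1 ∨ H i j = -1 := by
  have h := (Unitary.mem_iff.1 (hH.apply_mem i j)).1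
  rw [star_trivial] at h
  exact mul_self_eq_one_iff.1 h

/-- Orthogonality of rows `i` and `j` makes them differ in exactly four columns, so the pair has
four colours; orthogonality of a column to the column of ones makes both vertex classes have size
four. -/
lemma isBalanced_of_isFromHadamard {x : Triple 7} (hx : IsFromHadamard x) : IsBalanced x := by
  classical
  obtain ⟨φ, H, rfl, hH, h0, hφ⟩ := hx
  have hpm := eq_one_or_eq_neg_one_of_isHadamard hH
  refine ⟨rfl, fun _ => rfl, fun e => ?_, fun c => ?_⟩
  · obtain ⟨i, j, hij, rfl⟩ := exists_eq_pair e
    have h := congrFun (congrFun hH.mul_conjTranspose i) j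
    rw [Matrix.mul_apply, Fin.sum_univ_succ] at h
    simp only [Matrix.conjTranspose_apply, star_trivial, h0, Matrix.smul_apply,
      Matrix.one_apply_ne hij, smul_zero] at h
    have hs : ∀ c : Fin 7, H i c.succ * H j c.succ = sgn (c ∈ φ (pair hij)) := by
      intro c
      rcases hpm i c.succ with h1 | h1 <;> rcases hpm j c.succ with h2 | h2 <;>
        norm_num [sgn, hφ, h1, h2]
    simp only [hs, sum_sgn] at h
    simp only [filter_mem_eq_inter, univ_inter] at h
    have : ((φ (pair hij)).card : ℝ) = 4 := by linarith
    exact_mod_cast this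
  · have h := congrFun (congrFun hH.conjTranspose_mul 0) c.succ
    rw [Matrix.mul_apply] at h
    simp only [Matrix.conjTranspose_apply, star_trivial, h0, Matrix.smul_apply,
      Matrix.one_apply_ne (Fin.succ_ne_zero c).symm, smul_zero, one_mul] at h
    have hs : ∀ i, H i c.succ = 2 * (if H i c.succ = 1 then 1 else 0) - 1 := by
      intro i
      rcases hpm i c.succ with h1 | h1 <;> simp [h1] <;> norm_num
    rw [sum_congr rfl fun i _ => hs i, sum_sub_distrib, ← mul_sum, sum_boole] at h
    have hc : #{i | H i c.succ = 1} = 4 := by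
      have : (#{i | H i c.succ = 1} : ℝ) = 4 := by
        simp at h
        linarith
      exact_mod_cast this
    have c₁ : Fintype.card {i // H i c.succ = 1} = 4 := by rw [Fintype.card_subtype, hc]
    have c₂ : Fintype.card {i // ¬ H i c.succ = 1} = 4 := by
      rw [Fintype.card_subtype_compl, c₁]; rfl
    refine ⟨⟨(Equiv.sumCompl fun i => H i c.succ = 1).symm.trans
      (Equiv.sumCongr (Fintype.equivFinOfCardEq c₁) (Fintype.equivFinOfCardEq c₂)), ?_⟩⟩
    intro i j
    have hij : (colourGraph φ c).Adj i j ↔ H i c.succ ≠ H j c.succ := by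
      rw [colourGraph_adj]
      refine ⟨fun ⟨h, hc⟩ => (hφ i j h c).1 hc, fun h => ?_⟩
      have hne : i ≠ j := by rintro rfl; exact h rfl
      exact ⟨hne, (hφ i j hne c).2 h⟩
    rw [hij]
    rcases hpm i c.succ with h1 | h1 <;> rcases hpm j c.succ with h2 | h2
    · simp [Equiv.sumCompl_symm_apply_of_pos, h1, h2]
    · have h2' : ¬ H j c.succ = 1 := by rw [h2]; norm_num
      simp [Equiv.sumCompl_symm_apply_of_pos, Equiv.sumCompl_symm_apply_of_neg, h1, h2',
        ne_comm.1 h2']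
    · have h1' : ¬ H i c.succ = 1 := by rw [h1]; norm_num
      simp [Equiv.sumCompl_symm_apply_of_pos, Equiv.sumCompl_symm_apply_of_neg, h2, h1']
    · have h2' : ¬ H j c.succ = 1 := by rw [h2]; norm_num
      simp [Equiv.sumCompl_symm_apply_of_neg, h2', h1.trans h2.symm]

lemma feas_of_isBalanced {x : Triple 7} (hx : IsBalanced x) :
    x ∈ feas (fun _ : Fin 7 => 3) := by
  obtain ⟨r, φ, α⟩ := x
  obtain ⟨rfl, hα, hφ, hK⟩ := hx
  refine ⟨by norm_num, ⟨fun c => ?_, fun e => (hφ e).symm ▸ by norm_num⟩, fun i => ?_, ?_⟩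
  · obtain ⟨e⟩ := hK c
    have hcol : (completeBipartiteGraph (Fin 4) (Fin 4)).Colorable 2 :=
      (SimpleGraph.CompleteBipartiteGraph.bicoloring (Fin 4) (Fin 4)).colorable
    exact (hcol.cliqueFree (by norm_num)).comap ⟨e.toCopy⟩
  · simp only at hα ⊢
    rw [hα]; norm_num
  · simp only at hα ⊢
    simp [hα]

lemma objective_of_isBalanced {x : Triple 7} (hx : IsBalanced x) : objective x = 7 / 4 := by
  obtain ⟨r, φ, α⟩ := x
  obtain ⟨rfl, hα, hφ, -⟩ := hx
  have : ∀ e : Pair 8, (Sym2.map α e.val).mul * Real.logb 2 ((φ e).card : ℝ) = 1 / 32 := by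
    intro e
    obtain ⟨i, j, hij, rfl⟩ := exists_eq_pair e
    have h4 := logb_two_four
    simp only at hα hφ
    simp only [pair, Sym2.map_mk, Sym2.mul_mk, hα, hφ]
    norm_num [h4]
  simp only [objective, this, sum_const, card_univ, Sym2.card_subtype_not_diag]
  norm_num [Nat.choose]

/-- The sign matrix of order `8` whose entries are the characters of `(ZMod 2) ^ 3`. -/
def sylvester (i j : Fin 8) : ℤ :=
  (-1) ^ (i.val % 2 * (j.val % 2) + i.val / 2 % 2 * (j.val / 2 % 2) + i.val / 4 * (j.val / 4))

lemma sum_sylvester : ∀ i j, ∑ k, sylvester i k * sylvester j k = if i = j then 8 else 0 := by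
  decide

lemma isHadamard_sylvester :
    (Matrix.of fun i j => (sylvester i j : ℝ)).IsHadamard := by
  refine Matrix.IsHadamard.of_mul_conjTranspose (fun i j => ?_) ?_
    (IsRegular.of_ne_zero (by simp))
  · rw [Unitary.mem_iff]
    simp [sylvester, ← mul_pow]
  · ext i j
    rw [Matrix.mul_apply]
    simp only [Matrix.conjTranspose_apply, Matrix.of_apply, star_trivial]
    have := sum_sylvester i j
    have h : ∑ k, (sylvester i k : ℝ) * sylvester j k = ((if i = j then 8 else 0 : ℤ) : ℝ) := by
      rw [← this]; push_cast; rfl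
    rw [h]
    simp [Matrix.one_apply]

lemma exists_isFromHadamard : ∃ x, IsFromHadamard x := by
  classical
  -- A pair receives colour `c` when its two entries in column `c + 1` differ, phrased through
  -- `Sym2` so that no order of the pair is chosen.
  refine ⟨⟨8, fun e => {c | ¬ (Sym2.map (fun i => (sylvester i c.succ : ℝ)) e.val).IsDiag},
    fun _ => 1 / 8⟩, _, _, rfl, isHadamard_sylvester, fun i => ?_, fun i j h c => ?_⟩
  · simp [sylvester]
  · simp [pair]

end ErdosRothschild

open ErdosRothschild in
theorem mainTheorem7 :
    IsGreatest (ErdosRothschild.objective '' ErdosRothschild.feas (fun _ : Fin 7 => 3))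
      (ErdosRothschild.optValue (fun _ : Fin 7 => 3)) ∧
    ErdosRothschild.optValue (fun _ : Fin 7 => 3) = 7 / 4 ∧
    ∀ x : ErdosRothschild.Triple 7,
      (x ∈ ErdosRothschild.opt (fun _ : Fin 7 => 3) ↔ ErdosRothschild.IsBalanced x) ∧
      (x ∈ ErdosRothschild.opt (fun _ : Fin 7 => 3) ↔ ErdosRothschild.IsFromHadamard x) := by
  obtain ⟨x₀, hx₀⟩ := exists_isFromHadamard
  have hb₀ := isBalanced_of_isFromHadamard hx₀
  have hgreat : IsGreatest (objective '' feas (fun _ : Fin 7 => 3)) (7 / 4) :=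
    ⟨⟨x₀, feas_of_isBalanced hb₀, objective_of_isBalanced hb₀⟩,
      Set.forall_mem_image.2 fun _ => objective_le⟩
  have hval : optValue (fun _ : Fin 7 => 3) = 7 / 4 := hgreat.csSup_eq
  have hopt : ∀ x, x ∈ opt (fun _ : Fin 7 => 3) → IsFromHadamard x := fun x hx =>
    isFromHadamard_of_objective_eq hx.1 ((objective_le hx.1).antisymm
      (objective_of_isBalanced hb₀ ▸ hx.2 x₀ (feas_of_isBalanced hb₀)))
  have hbal : ∀ x, IsBalanced x → x ∈ opt (fun _ : Fin 7 => 3) := fun x hx =>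
    ⟨feas_of_isBalanced hx, fun y hy => objective_of_isBalanced hx ▸ objective_le hy⟩
  refine ⟨hval ▸ hgreat, hval, fun x => ⟨⟨fun h => isBalanced_of_isFromHadamard (hopt x h),
    hbal x⟩, ⟨hopt x, fun h => hbal x (isBalanced_of_isFromHadamard h)⟩⟩⟩
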